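/- Let $X$ and $Y$ be real Banach spaces and let $1<p,q<\infty$ satisfy $1/p+1/q\ge 1$. Suppose that $X$ has property $(R_p)$ and $Y$ has property $(R_q)$, where a real Banach space $E$ is said to have property $(R_r)$, $1<r<\infty$, if for every relatively weakly compact set $A\subseteq E$ which is not relatively norm compact there is a continuous linear map $u:E\to\ell_r$ such that $u(A)$ is not relatively norm compact. Let $(x_n)_{n\in\mathbb N}$ and $(y_n)_{n\in\mathbb N}$ be weakly Cauchy sequences in $X$ and $Y$, respectively, without norm convergent subsequences. Then $(x_n\otimes y_n)_{n\in\mathbb N}$ admits an $\ell_1$-subsequence in the projective tensor product $X\widehat{\otimes}_\pi Y$; that is, there is a strictly increasing sequence $(n_k)_{k\in\mathbb N}$ of indices such that $(x_{n_k}\otimes y_{n_k})_{k\in\mathbb N}$ is a basic sequence equivalent to the usual basis of $\ell_1$: there are constants $c,C>0$ with $$c\sum_{k\in F}|a_k|\le\Big\|\sum_{k\in F}a_k\,x_{n_k}\otimes y_{n_k}\Big\|\le C\sum_{k\in F}|a_k|$$ for every finite set $F\subseteq\mathbb N$ and all real scalars $(a_k)_{k\in F}$. Here $X\widehat{\otimes}_\pi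 Y$ is the completion of the algebraic tensor product $X\otimes Y$ under the norm $\|z\|=\sup|\tilde S(z)|$, where the supremum runs over all continuous bilinear functionals $S$ on $X\times Y$ with $\|S\|\le 1$ and $\tilde S$ is the linear functional on $X\otimes Y$ induced by $S$. -/

import Mathlib

open Filter Topology
open scoped TensorProduct ENNReal

universe u v

noncomputable section

section Sequences

variable {E : Type u} [NormedAddCommGroup E] [NormedSpace ℝ E]

/-- A set is relatively norm compact if its norm closure is norm compact. -/
def RelNormCompact (A : Set E) : Prop := IsCompact (closure A)

/-- A set is relatively weakly compact if its closure in the weak topology is weakly compact. -/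
def RelWeaklyCompact (A : Set E) : Prop :=
  IsCompact (closure (toWeakSpace ℝ E '' A))

/-- A sequence is weakly Cauchy if every continuous linear functional maps it to a
Cauchy sequence of real numbers. -/
def WeaklyCauchySeq (x : ℕ → E) : Prop :=
  ∀ f : StrongDual ℝ E, CauchySeq (fun n => f (x n))

/-- The sequence has some norm convergent subsequence. -/
def HasNormConvergentSubseq (x : ℕ → E) : Prop :=
  ∃ φ : ℕ → ℕ, StrictMono φ ∧ ∃ a : E, Tendsto (fun k => x (φ k)) atTop (𝓝 a)

/-- An `ℓ₁`-sequence: a (basic) sequence equivalent to the usual basis of `ℓ₁`, that is, the norm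
of each finite linear combination is comparable, up to fixed positive constants, with the
`ℓ₁`-norm of its coefficients. -/
def IsEllOneSeq (x : ℕ → E) : Prop :=
  ∃ c C : ℝ, 0 < c ∧ 0 < C ∧ ∀ (s : Finset ℕ) (a : ℕ → ℝ),
    c * ∑ i ∈ s, |a i| ≤ ‖∑ i ∈ s, a i • x i‖ ∧
      ‖∑ i ∈ s, a i • x i‖ ≤ C * ∑ i ∈ s, |a i|

end Sequences

/-- Property `(R_p)`: for every relatively weakly compact set `A ⊆ X` that is not relatively norm
compact there is an operator `u : X → ℓ_p` such that `u(A)` is not relatively norm compact. -/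
def PropertyR (p : ℝ≥0∞) [Fact (1 ≤ p)] (X : Type u) [NormedAddCommGroup X] [NormedSpace ℝ X] :
    Prop :=
  ∀ A : Set X, RelWeaklyCompact A → ¬ RelNormCompact A →
    ∃ u : X →L[ℝ] lp (fun _ : ℕ => ℝ) p, ¬ RelNormCompact (u '' A)

section ProjectiveTensorProduct

/-- The algebraic tensor product `X ⊗ Y` of two real normed spaces, as a type that carries
the projective norm. -/
def AlgTensor (X : Type u) (Y : Type v) [NormedAddCommGroup X] [NormedSpace ℝ X]
    [NormedAddCommGroup Y] [NormedSpace ℝ Y] : Type (max u v) :=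
  X ⊗[ℝ] Y

variable (X : Type u) (Y : Type v) [NormedAddCommGroup X] [NormedSpace ℝ X]
  [NormedAddCommGroup Y] [NormedSpace ℝ Y]

instance AlgTensor.instAddCommGroup : AddCommGroup (AlgTensor X Y) :=
  inferInstanceAs (AddCommGroup (X ⊗[ℝ] Y))

instance AlgTensor.instModule : Module ℝ (AlgTensor X Y) :=
  inferInstanceAs (Module ℝ (X ⊗[ℝ] Y))

variable {X Y}

/-- The elementary tensor `x ⊗ y` in the algebraic tensor product. -/
def AlgTensor.tmul (x : X) (y : Y) : AlgTensor X Y := x ⊗ₜ[ℝ] y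

/-- The linear functional on the algebraic tensor product induced by a continuous bilinear
functional `S` on `X × Y`; it sends `x ⊗ y` to `S x y`. -/
def AlgTensor.lift (S : X →L[ℝ] Y →L[ℝ] ℝ) : AlgTensor X Y →ₗ[ℝ] ℝ :=
  TensorProduct.lift S.toLinearMap₁₂

theorem AlgTensor.lift_tmul (S : X →L[ℝ] Y →L[ℝ] ℝ) (x : X) (y : Y) :
    AlgTensor.lift S (AlgTensor.tmul x y) = S x y := rfl

/-- The projective norm: the supremum of `|S̃ z|` over all continuous bilinear functionals `S`
on `X × Y` with `‖S‖ ≤ 1`. -/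
instance AlgTensor.instNorm : Norm (AlgTensor X Y) :=
  ⟨fun z => ⨆ S : {S : X →L[ℝ] Y →L[ℝ] ℝ // ‖S‖ ≤ 1}, |AlgTensor.lift S.1 z|⟩

theorem AlgTensor.norm_def (z : AlgTensor X Y) :
    ‖z‖ = ⨆ S : {S : X →L[ℝ] Y →L[ℝ] ℝ // ‖S‖ ≤ 1}, |AlgTensor.lift S.1 z| := rfl

theorem AlgTensor.exists_bound (z : AlgTensor X Y) :
    ∃ M : ℝ, ∀ S : X →L[ℝ] Y →L[ℝ] ℝ, ‖S‖ ≤ 1 → |AlgTensor.lift S z| ≤ M := by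
  induction z using TensorProduct.induction_on with
  | zero => exact ⟨0, fun S _ => (congrArg abs (map_zero (AlgTensor.lift S))).trans_le (by simp)⟩
  | tmul x y =>
    refine ⟨‖x‖ * ‖y‖, fun S hS => ?_⟩
    change ‖S x y‖ ≤ _
    calc ‖S x y‖ ≤ ‖S‖ * ‖x‖ * ‖y‖ := S.le_opNorm₂ x y
      _ ≤ 1 * ‖x‖ * ‖y‖ := by gcongr
      _ = ‖x‖ * ‖y‖ := by ring
  | add z w hz hw =>
    obtain ⟨M, hM⟩ := hz
    obtain ⟨N, hN⟩ := hw
    refine ⟨M + N, fun S hS => ?_⟩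
    rw [show AlgTensor.lift S (z + w) = AlgTensor.lift S z + AlgTensor.lift S w from map_add _ _ _]
    exact (abs_add_le _ _).trans (add_le_add (hM S hS) (hN S hS))

theorem AlgTensor.bddAbove (z : AlgTensor X Y) :
    BddAbove (Set.range fun S : {S : X →L[ℝ] Y →L[ℝ] ℝ // ‖S‖ ≤ 1} => |AlgTensor.lift S.1 z|) := by
  obtain ⟨M, hM⟩ := AlgTensor.exists_bound z
  refine ⟨M, ?_⟩
  rintro _ ⟨S, rfl⟩
  exact hM S.1 S.2

theorem AlgTensor.abs_lift_le_norm (S : X →L[ℝ] Y →L[ℝ] ℝ) (hS : ‖S‖ ≤ 1) (z : AlgTensor X Y) :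
    |AlgTensor.lift S z| ≤ ‖z‖ :=
  le_ciSup (AlgTensor.bddAbove z) ⟨S, hS⟩

/-- Continuous bilinear functionals separate the points of the algebraic tensor product. -/
theorem AlgTensor.eq_zero_of_lift (z : AlgTensor X Y)
    (hz : ∀ S : X →L[ℝ] Y →L[ℝ] ℝ, AlgTensor.lift S z = 0) : z = 0 := by
  let b := Module.Basis.ofVectorSpace ℝ Y
  obtain ⟨c, hc⟩ := TensorProduct.eq_repr_basis_right b (z : X ⊗[ℝ] Y)
  have key : c = 0 := by
    ext i
    refine SeparatingDual.eq_zero_of_forall_dual_eq_zero (R := ℝ) fun f => ?_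
    have hsum : (c.sum fun i m => f m • b i) = 0 := by
      refine SeparatingDual.eq_zero_of_forall_dual_eq_zero (R := ℝ) fun g => ?_
      have h := hz (f.smulRight g)
      have h2 : AlgTensor.lift (f.smulRight g) z
          = c.sum fun i m => f m * g (b i) := by
        rw [← hc]
        unfold Finsupp.sum
        exact map_sum (TensorProduct.lift (f.smulRight g).toLinearMap₁₂) _ _
      rw [h2] at h
      simpa [Finsupp.sum, map_sum] using h
    have hli := b.linearIndependent
    rw [linearIndependent_iff'] at hli
    by_cases hi : i ∈ c.support
    · exact hli c.support (fun i => f (c i)) hsum i hi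
    · rw [Finsupp.notMem_support_iff.mp hi, map_zero]
  subst key
  exact hc.symm.trans Finsupp.sum_zero_index

theorem AlgTensor.normedSpaceCore : NormedSpace.Core ℝ (AlgTensor X Y) where
  norm_nonneg z := Real.iSup_nonneg fun _ => abs_nonneg _
  norm_smul r z := by
    simp only [AlgTensor.norm_def, map_smul, smul_eq_mul, abs_mul, Real.norm_eq_abs]
    exact (Real.mul_iSup_of_nonneg (abs_nonneg r) _).symm
  norm_triangle z w := by
    have : Nonempty {S : X →L[ℝ] Y →L[ℝ] ℝ // ‖S‖ ≤ 1} :=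
      ⟨⟨0, (norm_zero (E := X →L[ℝ] Y →L[ℝ] ℝ)).trans_le zero_le_one⟩⟩
    refine ciSup_le fun S => ?_
    rw [map_add]
    exact (abs_add_le _ _).trans
      (add_le_add (AlgTensor.abs_lift_le_norm S.1 S.2 z) (AlgTensor.abs_lift_le_norm S.1 S.2 w))
  norm_eq_zero_iff z := by
    constructor
    · intro h
      refine AlgTensor.eq_zero_of_lift z fun S => ?_
      have hpos : 0 < ‖S‖ + 1 := by positivity
      have h1 : ‖(‖S‖ + 1)⁻¹ • S‖ ≤ 1 := by
        refine (ContinuousLinearMap.opNorm_smul_le _ S).trans ?_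
        rw [norm_inv, Real.norm_of_nonneg hpos.le, inv_mul_le_iff₀ hpos]
        linarith
      have h2 := AlgTensor.abs_lift_le_norm _ h1 z
      rw [h] at h2
      have h3 : AlgTensor.lift ((‖S‖ + 1)⁻¹ • S) z = (‖S‖ + 1)⁻¹ * AlgTensor.lift S z := by
        have : AlgTensor.lift ((‖S‖ + 1)⁻¹ • S) = (‖S‖ + 1)⁻¹ • AlgTensor.lift S :=
          TensorProduct.ext' fun x y => rfl
        rw [this]
        rfl
      rw [h3] at h2
      have h4 := abs_eq_zero.mp (le_antisymm h2 (abs_nonneg _))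
      exact (mul_eq_zero.mp h4).resolve_left (inv_ne_zero hpos.ne')
    · rintro rfl
      simp [AlgTensor.norm_def]

instance AlgTensor.instNormedAddCommGroup : NormedAddCommGroup (AlgTensor X Y) :=
  NormedAddCommGroup.ofCore AlgTensor.normedSpaceCore

instance AlgTensor.instNormedSpace : NormedSpace ℝ (AlgTensor X Y) :=
  NormedSpace.ofCore AlgTensor.normedSpaceCore

variable (X Y) in
/-- The projective tensor product `X ⊗̂_π Y`: the completion of the algebraic tensor product with
respect to the projective norm. -/
abbrev ProjTensor : Type (max u v) := UniformSpace.Completion (AlgTensor X Y)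

/-- The elementary tensor `x ⊗ y` in the projective tensor product. -/
def ProjTensor.tmul (x : X) (y : Y) : ProjTensor X Y :=
  ((AlgTensor.tmul x y : AlgTensor X Y) : UniformSpace.Completion (AlgTensor X Y))

end ProjectiveTensorProduct

end

/-!
The lower `ℓ₁`-estimate is tested against diagonal bilinear functionals
`S(a, b) = ∑ k ∈ s, θ k * φ k a * ψ k b` with `|θ k| ≤ 1`. If `a ↦ (φ k a)_k` is a contraction into
`ℓ_p` and `b ↦ (ψ k b)_k` one into `ℓ_q`, then `‖S‖ ≤ 1` by Hölder's inequality, and this is where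
`1 / p + 1 / q ≥ 1` enters (`norm_diagonalForm_le`). If moreover `φ k (x k) ≥ δ`,
`ψ k (y k) ≥ δ'` and the off-diagonal values `φ k (x n)` are small enough in comparison, choosing
`θ k` to be the sign of the `k`-th coefficient bounds `‖∑ a k • x k ⊗ y k‖` below by
`(δ * δ' / 2) * ∑ |a k|` (`isEllOneSeq_tmul`).

Such functionals come from property `(R_p)` (`PropertyR.exists_upperEstimate`). As `x` is weakly
but not norm Cauchy, some differences of its terms form a weakly null sequence bounded away from
zero; its range is relatively weakly compact and not relatively norm compact, so an operator `u`
into `ℓ_p` does not map these differences to a norm null sequence. Their images are coordinatewise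
null, so the tails of the vectors `u (x n)` are not uniformly small, and a gliding hump argument
yields disjoint finite blocks on which `u (x n)` stays large along a subsequence. The `φ k` are
norming functionals of these blocks. The off-diagonal values become small on a further subsequence
(`UpperEstimate.exists_almost_biorthogonal`): `φ k a → 0` for every `a` because
`(φ k a)_k ∈ ℓ_p`, and the limits of `φ k (x n)` as `n → ∞`, which exist as `x` is weakly Cauchy,
form again a sequence in `ℓ_p`. All properties pass to subsequences, so `x` and `y` can be
treated one after the other.
-/

/-! ### Weakly Cauchy sequences -/

section WeaklyCauchy

variable {E : Type u} [NormedAddCommGroup E] [NormedSpace ℝ E]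

theorem WeaklyCauchySeq.comp {x : ℕ → E} (hx : WeaklyCauchySeq x) {φ : ℕ → ℕ}
    (hφ : StrictMono φ) : WeaklyCauchySeq (x ∘ φ) := fun f =>
  (hx f).comp_tendsto hφ.tendsto_atTop

/-- Weakly Cauchy sequences are norm bounded, by the uniform boundedness principle applied to
their image in the bidual. -/
theorem WeaklyCauchySeq.exists_norm_le {x : ℕ → E} (hx : WeaklyCauchySeq x) :
    ∃ M : ℝ, 0 < M ∧ ∀ n, ‖x n‖ ≤ M := by
  obtain ⟨C, hC⟩ := banach_steinhaus (g := fun n => NormedSpace.inclusionInDoubleDual ℝ E (x n))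
    fun f => by
      obtain ⟨C, hC⟩ := (hx f).isBounded_range.exists_norm_le
      exact ⟨C, fun n => hC _ ⟨n, rfl⟩⟩
  refine ⟨max C 1, by positivity, fun n => le_max_of_le_left ?_⟩
  have h := (NormedSpace.inclusionInDoubleDualLi (𝕜 := ℝ) (E := E)).norm_map (x n)
  exact h.symm.trans_le (hC n)

/-- A sequence that is weakly Cauchy but not norm Cauchy has differences of arbitrarily late
terms that form a weakly null sequence bounded away from zero. -/
theorem WeaklyCauchySeq.exists_differences {x : ℕ → E} (hx : WeaklyCauchySeq x)
    (hn : ¬ CauchySeq x) :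
    ∃ m n : ℕ → ℕ, (∀ k, k ≤ m k) ∧ (∀ k, k ≤ n k) ∧
      (∀ f : StrongDual ℝ E, Tendsto (fun k => f (x (m k) - x (n k))) atTop (𝓝 0)) ∧
      ∃ ε : ℝ, 0 < ε ∧ ∀ k, ε ≤ ‖x (m k) - x (n k)‖ := by
  rw [Metric.cauchySeq_iff] at hn
  push Not at hn
  obtain ⟨ε, hε, h⟩ := hn
  choose m hm n hn' hmn using h
  refine ⟨m, n, hm, hn', fun f => ?_, ε, hε, fun k => by simpa [dist_eq_norm] using hmn k⟩
  obtain ⟨l, hl⟩ := cauchySeq_tendsto_of_complete (hx f)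
  have h1 := hl.comp (tendsto_atTop_mono hm tendsto_id)
  have h2 := hl.comp (tendsto_atTop_mono hn' tendsto_id)
  simpa using h1.sub h2

theorem not_cauchySeq_comp_of_not_hasNormConvergentSubseq {E : Type*} [NormedAddCommGroup E]
    [CompleteSpace E] {x : ℕ → E}
    (hx : ¬ HasNormConvergentSubseq x) {φ : ℕ → ℕ} (hφ : StrictMono φ) :
    ¬ CauchySeq (x ∘ φ) := fun h =>
  hx ⟨φ, hφ, cauchySeq_tendsto_of_complete h⟩

theorem relWeaklyCompact_range_of_tendsto_zero {z : ℕ → E}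
    (hz : ∀ f : StrongDual ℝ E, Tendsto (fun k => f (z k)) atTop (𝓝 0)) :
    RelWeaklyCompact (Set.range z) := by
  have ht : Tendsto (fun k => toWeakSpace ℝ E (z k)) atTop (𝓝 (toWeakSpace ℝ E 0)) := by
    refine (WeakBilin.tendsto_iff_forall_eval_tendsto (B := (topDualPairing ℝ E).flip) ?_).2 ?_
    · intro a b hab
      by_contra hne
      obtain ⟨f, hf⟩ := SeparatingDual.exists_separating_of_ne (R := ℝ) hne
      exact hf (DFunLike.congr_fun hab f)
    · intro f
      have h := hz f
      rw [← map_zero f] at h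
      exact h
  refine ht.isCompact_insert_range.of_isClosed_subset isClosed_closure ?_
  refine closure_minimal ?_ ht.isCompact_insert_range.isClosed
  rw [← Set.range_comp]
  exact Set.subset_insert _ _

theorem not_relNormCompact_range_of_tendsto_zero {z : ℕ → E}
    (hz : ∀ f : StrongDual ℝ E, Tendsto (fun k => f (z k)) atTop (𝓝 0))
    {ε : ℝ} (hε : 0 < ε) (hzε : ∀ k, ε ≤ ‖z k‖) : ¬ RelNormCompact (Set.range z) := by
  intro hc
  obtain ⟨a, -, φ, hφ, ha⟩ := hc.tendsto_subseq fun n => subset_closure (Set.mem_range_self n)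
  have ha0 : a = 0 := SeparatingDual.eq_zero_of_forall_dual_eq_zero (R := ℝ) fun f =>
    tendsto_nhds_unique ((f.continuous.tendsto a).comp ha) ((hz f).comp hφ.tendsto_atTop)
  have h := ge_of_tendsto' ha.norm fun n => hzε (φ n)
  rw [ha0, norm_zero] at h
  exact hε.not_ge h

theorem relNormCompact_range_of_tendsto {E : Type*} [NormedAddCommGroup E] {z : ℕ → E} {a : E} (hz : Tendsto z atTop (𝓝 a)) :
    RelNormCompact (Set.range z) :=
  hz.isCompact_insert_range.of_isClosed_subset isClosed_closure
    (closure_minimal (Set.subset_insert _ _) hz.isCompact_insert_range.isClosed)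

/-- Property `(R_p)` detects, through a contraction into `ℓ_p`, that a weakly null sequence is
bounded away from zero. -/
theorem PropertyR.exists_not_tendsto_zero {p : ℝ≥0∞} [Fact (1 ≤ p)] (hE : PropertyR p E)
    {z : ℕ → E} (hz : ∀ f : StrongDual ℝ E, Tendsto (fun k => f (z k)) atTop (𝓝 0))
    {ε : ℝ} (hε : 0 < ε) (hzε : ∀ k, ε ≤ ‖z k‖) :
    ∃ u : E →L[ℝ] lp (fun _ : ℕ => ℝ) p, ‖u‖ ≤ 1 ∧
      ¬ Tendsto (fun k => u (z k)) atTop (𝓝 0) := by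
  obtain ⟨u, hu⟩ := hE _ (relWeaklyCompact_range_of_tendsto_zero hz)
    (not_relNormCompact_range_of_tendsto_zero hz hε hzε)
  have hpos : 0 < ‖u‖ + 1 := by positivity
  refine ⟨(‖u‖ + 1)⁻¹ • u, ?_, fun h => hu ?_⟩
  · rw [norm_smul, norm_inv, Real.norm_of_nonneg hpos.le, inv_mul_le_iff₀ hpos]
    linarith
  · have h2 := h.const_smul (‖u‖ + 1)
    simp only [_root_.smul_apply, smul_inv_smul₀ hpos.ne', smul_zero] at h2
    rw [← Set.range_comp]
    exact relNormCompact_range_of_tendsto h2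

end WeaklyCauchy

/-! ### Gliding humps in `ℓ_p` -/

section Blocks

variable {p : ℝ≥0∞} [Fact (1 ≤ p)]

/-- The projection of `ℓ_p` onto the coordinates in the finite set `B`. -/
noncomputable def blockProj (p : ℝ≥0∞) [Fact (1 ≤ p)] (B : Finset ℕ) :
    lp (fun _ : ℕ => ℝ) p →L[ℝ] lp (fun _ : ℕ => ℝ) p :=
  ∑ i ∈ B, lp.singleContinuousLinearMap ℝ (fun _ : ℕ => ℝ) p i ∘L lp.evalCLM ℝ (fun _ : ℕ => ℝ) p i

theorem blockProj_apply (B : Finset ℕ) (v : lp (fun _ : ℕ => ℝ) p) :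
    blockProj p B v = ∑ i ∈ B, lp.single p i (v i) := by
  simp only [blockProj, _root_.sum_apply]
  rfl

theorem norm_blockProj_rpow (hp : 0 < p.toReal) (B : Finset ℕ) (v : lp (fun _ : ℕ => ℝ) p) :
    ‖blockProj p B v‖ ^ p.toReal = ∑ i ∈ B, ‖v i‖ ^ p.toReal := by
  rw [blockProj_apply]
  exact lp.norm_sum_single hp (fun i => v i) B

theorem sum_norm_blockProj_rpow_le (hp : 0 < p.toReal) {B : ℕ → Finset ℕ}
    (hB : Pairwise (Function.onFun Disjoint B)) (s : Finset ℕ) (v : lp (fun _ : ℕ => ℝ) p) :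
    ∑ k ∈ s, ‖blockProj p (B k) v‖ ^ p.toReal ≤ ‖v‖ ^ p.toReal := by
  simp only [norm_blockProj_rpow hp]
  rw [← Finset.sum_biUnion fun i _ j _ hij => hB hij]
  exact lp.sum_rpow_le_norm_rpow hp v _

theorem tendsto_blockProj_range (hp : p ≠ ∞) (v : lp (fun _ : ℕ => ℝ) p) :
    Tendsto (fun N => blockProj p (Finset.range N) v) atTop (𝓝 v) := by
  simp only [blockProj_apply]
  exact (lp.hasSum_single hp v).tendsto_sum_nat

theorem blockProj_Ico {N M : ℕ} (h : N ≤ M) (v : lp (fun _ : ℕ => ℝ) p) :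
    blockProj p (Finset.Ico N M) v =
      blockProj p (Finset.range M) v - blockProj p (Finset.range N) v := by
  simp only [blockProj_apply]
  exact Finset.sum_Ico_eq_sub _ h

/-- A vector with a large tail has a large finite block beyond any given coordinate. -/
theorem exists_le_norm_blockProj_Ico (hp : p ≠ ∞) {v : lp (fun _ : ℕ => ℝ) p} {N : ℕ} {ε : ℝ}
    (h : ε < ‖v - blockProj p (Finset.range N) v‖) :
    ∃ M, N ≤ M ∧ ε ≤ ‖blockProj p (Finset.Ico N M) v‖ := by
  have ht : Tendsto (fun M => ‖blockProj p (Finset.range M) v - blockProj p (Finset.range N) v‖)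
      atTop (𝓝 ‖v - blockProj p (Finset.range N) v‖) :=
    ((tendsto_blockProj_range hp v).sub_const _).norm
  obtain ⟨M, hM, hNM⟩ := ((ht.eventually_const_lt h).and (eventually_ge_atTop N)).exists
  exact ⟨M, hNM, by rw [blockProj_Ico hNM]; exact hM.le⟩

end Blocks

/-! ### Functionals with an upper `r`-estimate -/

section UpperEstimate

variable {E : Type u} [NormedAddCommGroup E] [NormedSpace ℝ E]

/-- A sequence of functionals `φ` satisfies an upper `r`-estimate (with constant one) if
`z ↦ (φ k z)_k` is a contraction into `ℓ_r`; the condition is stated on finite sets of indices. -/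
def UpperEstimate (r : ℝ) (φ : ℕ → StrongDual ℝ E) : Prop :=
  ∀ (s : Finset ℕ) (z : E), ∑ k ∈ s, |φ k z| ^ r ≤ ‖z‖ ^ r

theorem UpperEstimate.comp {r : ℝ} {φ : ℕ → StrongDual ℝ E} (h : UpperEstimate r φ) {n : ℕ → ℕ}
    (hn : StrictMono n) : UpperEstimate r (φ ∘ n) := fun s z => by
  have := h (s.map ⟨n, hn.injective⟩) z
  rwa [Finset.sum_map] at this

theorem UpperEstimate.abs_apply_le {r : ℝ} (hr : 0 < r) {φ : ℕ → StrongDual ℝ E}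
    (h : UpperEstimate r φ) (k : ℕ) (z : E) : |φ k z| ≤ ‖z‖ := by
  have := h {k} z
  rw [Finset.sum_singleton] at this
  exact (Real.rpow_le_rpow_iff (abs_nonneg _) (norm_nonneg _) hr).1 this

theorem tendsto_zero_of_sum_rpow_le {r : ℝ} (hr : 0 < r) {a : ℕ → ℝ} {C : ℝ}
    (h : ∀ s : Finset ℕ, ∑ k ∈ s, |a k| ^ r ≤ C) : Tendsto a atTop (𝓝 0) := by
  have hs : Summable fun k => |a k| ^ r :=
    summable_of_sum_le (fun k => by positivity) h
  have h1 := hs.tendsto_atTop_zero.rpow_const (p := r⁻¹) (Or.inr (by positivity))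
  rw [Real.zero_rpow (inv_ne_zero hr.ne')] at h1
  refine (tendsto_zero_iff_abs_tendsto_zero a).2 (h1.congr fun k => ?_)
  exact Real.rpow_rpow_inv (abs_nonneg _) hr.ne'

/-- If `E` has property `(R_p)`, a weakly Cauchy sequence that is not norm Cauchy has a
subsequence on which functionals with an upper `p`-estimate are uniformly large. They are norming
functionals of disjoint blocks of the images of the sequence in `ℓ_p`. -/
theorem PropertyR.exists_upperEstimate {p : ℝ≥0∞} [Fact (1 ≤ p)] (hp : p ≠ ∞)
    (hE : PropertyR p E) {x : ℕ → E} (hx : WeaklyCauchySeq x) (hxn : ¬ CauchySeq x) :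
    ∃ (n : ℕ → ℕ) (φ : ℕ → StrongDual ℝ E) (δ : ℝ), StrictMono n ∧ 0 < δ ∧
      UpperEstimate p.toReal φ ∧ ∀ k, δ ≤ φ k (x (n k)) := by
  have hp0 : 0 < p.toReal :=
    ENNReal.toReal_pos (zero_lt_one.trans_le (Fact.out : 1 ≤ p)).ne' hp
  obtain ⟨m, n, hm, hn, hz, ε, hε, hzε⟩ := hx.exists_differences hxn
  obtain ⟨u, hu, hlim⟩ := hE.exists_not_tendsto_zero hz hε hzε
  obtain ⟨δ, hδ, hfreq⟩ : ∃ δ : ℝ, 0 < δ ∧ ∃ᶠ k in atTop, δ ≤ ‖u (x (m k) - x (n k))‖ := by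
    rw [tendsto_zero_iff_norm_tendsto_zero, Metric.tendsto_nhds] at hlim
    push Not at hlim
    obtain ⟨δ, hδ, h⟩ := hlim
    exact ⟨δ, hδ, h.mono fun k hk => by simpa using hk⟩
  -- The initial segments of `u (x (m k) - x (n k))` tend to zero by weak nullness, so the mass
  -- `δ` sits in the tails; one of the two vectors carries a large part of it.
  have htail : ∀ N K : ℕ, ∃ l, K ≤ l ∧
      δ / 4 < ‖u (x l) - blockProj p (Finset.range N) (u (x l))‖ := by
    intro N K
    have h0 : Tendsto (fun k => blockProj p (Finset.range N) (u (x (m k) - x (n k)))) atTop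
        (𝓝 0) := by
      have hi : ∀ i ∈ Finset.range N, Tendsto
          (fun k => lp.single (E := fun _ : ℕ => ℝ) p i (u (x (m k) - x (n k)) i)) atTop
          (𝓝 0) := fun i _ => by
        have := ((lp.singleContinuousLinearMap ℝ (fun _ : ℕ => ℝ) p i).continuous.tendsto 0).comp
          (hz (lp.evalCLM ℝ (fun _ : ℕ => ℝ) p i ∘L u))
        rw [map_zero] at this
        exact this
      simp only [blockProj_apply]
      simpa using tendsto_finsetSum _ hi
    obtain ⟨k, hk1, hk2, hk3⟩ := (hfreq.and_eventually
      ((h0.norm.eventually_lt_const (show ‖(0 : lp (fun _ : ℕ => ℝ) p)‖ < δ / 4 by rw [norm_zero]; positivity)).and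
        (eventually_ge_atTop K))).exists
    by_contra! hcon
    have h1 := hcon (m k) (hk3.trans (hm k))
    have h2 := hcon (n k) (hk3.trans (hn k))
    have h3 : u (x (m k) - x (n k)) =
        (u (x (m k)) - blockProj p (Finset.range N) (u (x (m k)))) -
          (u (x (n k)) - blockProj p (Finset.range N) (u (x (n k)))) +
          blockProj p (Finset.range N) (u (x (m k) - x (n k))) := by
      simp only [map_sub]; abel
    have h4 := norm_add_le ((u (x (m k)) - blockProj p (Finset.range N) (u (x (m k)))) -
          (u (x (n k)) - blockProj p (Finset.range N) (u (x (n k)))))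
          (blockProj p (Finset.range N) (u (x (m k) - x (n k))))
    rw [← h3] at h4
    have h5 := norm_sub_le (u (x (m k)) - blockProj p (Finset.range N) (u (x (m k))))
      (u (x (n k)) - blockProj p (Finset.range N) (u (x (n k))))
    linarith
  -- A triple `(l, N, M)` records the index `l` and the block `[N, M)`.
  obtain ⟨f, hf, hmono⟩ := exists_seq_of_forall_finset_exists
    (fun t : ℕ × ℕ × ℕ => δ / 4 ≤ ‖blockProj p (Finset.Ico t.2.1 t.2.2) (u (x t.1))‖)
    (fun t t' => t.1 < t'.1 ∧ t.2.2 ≤ t'.2.1) fun s _ => by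
      obtain ⟨l, hl, hl'⟩ := htail (s.sup fun t => t.2.2) (s.sup (fun t => t.1) + 1)
      obtain ⟨M, -, hM⟩ := exists_le_norm_blockProj_Ico hp hl'
      exact ⟨(l, s.sup fun t => t.2.2, M), hM, fun t ht =>
        ⟨(Nat.lt_succ_of_le (Finset.le_sup (f := fun t : ℕ × ℕ × ℕ => t.1) ht)).trans_le hl,
          Finset.le_sup (f := fun t : ℕ × ℕ × ℕ => t.2.2) ht⟩⟩
  let B : ℕ → Finset ℕ := fun k => Finset.Ico (f k).2.1 (f k).2.2
  have hB : Pairwise (Function.onFun Disjoint B) :=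
    (pairwise_disjoint_on B).2 fun i j hij => by
      have := (hmono i j hij).2
      exact Finset.disjoint_left.2 fun a ha hb => by
        simp only [B, Finset.mem_Ico] at ha hb
        omega
  choose g hg hgx using fun k => exists_dual_vector'' ℝ (blockProj p (B k) (u (x (f k).1)))
  refine ⟨fun k => (f k).1, fun k => g k ∘L blockProj p (B k) ∘L u, δ / 4,
    fun i j hij => (hmono i j hij).1, by positivity, fun s z => ?_, fun k => ?_⟩
  · calc ∑ k ∈ s, |(g k ∘L blockProj p (B k) ∘L u) z| ^ p.toReal
        ≤ ∑ k ∈ s, ‖blockProj p (B k) (u z)‖ ^ p.toReal := by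
          refine Finset.sum_le_sum fun k _ => Real.rpow_le_rpow (abs_nonneg _) ?_ hp0.le
          exact (g k).le_of_opNorm_le_of_le (hg k) le_rfl |>.trans_eq (one_mul _)
      _ ≤ ‖u z‖ ^ p.toReal := sum_norm_blockProj_rpow_le hp0 hB s _
      _ ≤ ‖z‖ ^ p.toReal := by
          refine Real.rpow_le_rpow (norm_nonneg _) ?_ hp0.le
          exact (u.le_of_opNorm_le hu z).trans_eq (one_mul _)
  · change δ / 4 ≤ g k (blockProj p (B k) (u (x (f k).1)))
    rw [hgx]
    exact hf k

/-- Along a weakly Cauchy sequence, functionals with an upper estimate become almost biorthogonal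
after passing to a subsequence. -/
theorem UpperEstimate.exists_almost_biorthogonal {r : ℝ} (hr : 0 < r) {φ : ℕ → StrongDual ℝ E}
    (h : UpperEstimate r φ) {x : ℕ → E} (hx : WeaklyCauchySeq x) {η : ℝ} (hη : 0 < η) :
    ∃ n : ℕ → ℕ, StrictMono n ∧
      ∀ i j, i ≠ j → |φ (n i) (x (n j))| ≤ η * (1 / 2) ^ i := by
  obtain ⟨M, hM, hxM⟩ := hx.exists_norm_le
  choose L hL using fun k => cauchySeq_tendsto_of_complete (hx (φ k))
  have hL0 : Tendsto L atTop (𝓝 0) := by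
    refine tendsto_zero_of_sum_rpow_le hr (C := M ^ r) fun s => ?_
    refine le_of_tendsto' (tendsto_finsetSum s fun k _ =>
      ((hL k).abs.rpow_const (p := r) (Or.inr hr.le))) fun n => (h s (x n)).trans ?_
    exact Real.rpow_le_rpow (norm_nonneg _) (hxM n) hr.le
  have hcol : ∀ z, Tendsto (fun k => φ k z) atTop (𝓝 0) := fun z =>
    tendsto_zero_of_sum_rpow_le hr fun s => h s z
  -- A pair `(k, n)` records the index `n` and the exponent `k` of the required smallness.
  obtain ⟨f, -, hf⟩ := exists_seq_of_forall_finset_exists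
    (fun t : ℕ × ℕ => |L t.2| < η * (1 / 2) ^ t.1)
    (fun t t' => t.1 < t'.1 ∧ t.2 < t'.2 ∧ |φ t'.2 (x t.2)| < η * (1 / 2) ^ t'.1 ∧
      |φ t.2 (x t'.2)| < η * (1 / 2) ^ t.1) fun s hs => by
      set K := s.sup (fun t => t.1) + 1
      have hpos : 0 < η * (1 / 2) ^ K := by positivity
      have small : ∀ {a : ℕ → ℝ}, Tendsto a atTop (𝓝 0) → ∀ᶠ n in atTop,
          |a n| < η * (1 / 2) ^ K := fun ha =>
        ha.abs.eventually_lt_const (by simpa using hpos)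
      have hev : ∀ᶠ n in atTop, ∀ t ∈ s, t.2 < n ∧ |φ n (x t.2)| < η * (1 / 2) ^ K ∧
          |φ t.2 (x n)| < η * (1 / 2) ^ t.1 :=
        (Finset.eventually_all s).2 fun t ht => (eventually_gt_atTop _).and
          ((small (hcol _)).and ((hL t.2).abs.eventually_lt_const (hs t ht)))
      obtain ⟨n, hn1, hn2⟩ := ((small hL0).and hev).exists
      exact ⟨(K, n), hn1, fun t ht =>
        ⟨Nat.lt_succ_of_le (Finset.le_sup (f := fun t : ℕ × ℕ => t.1) ht), hn2 t ht⟩⟩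
  have hid : ∀ i, i ≤ (f i).1 := fun _ =>
    (show StrictMono fun i => (f i).1 from fun i j hij => (hf i j hij).1).le_apply
  have hpow : ∀ i, η * (1 / 2 : ℝ) ^ (f i).1 ≤ η * (1 / 2) ^ i := fun i =>
    mul_le_mul_of_nonneg_left (pow_le_pow_of_le_one (by norm_num) (by norm_num) (hid i)) hη.le
  refine ⟨fun i => (f i).2, fun i j hij => (hf i j hij).2.1, fun i j hij => ?_⟩
  rcases hij.lt_or_gt with hlt | hlt
  · exact (hf i j hlt).2.2.2.le.trans (hpow i)
  · exact (hf j i hlt).2.2.1.le.trans (hpow i)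

end UpperEstimate

/-! ### Diagonal bilinear functionals -/

section Diagonal

/-- Hölder's inequality for exponents `r, t` with `1 / r + 1 / t ≥ 1`, normalized form: Young's
inequality for `r` and its conjugate exponent, which is at least `t`. -/
theorem sum_abs_mul_abs_le_one {r t : ℝ} (hr : 1 < r) (ht : 0 < t) (hrt : 1 ≤ 1 / r + 1 / t)
    {s : Finset ℕ} {a b : ℕ → ℝ} (ha : ∑ k ∈ s, |a k| ^ r ≤ 1) (hb : ∑ k ∈ s, |b k| ^ t ≤ 1) :
    ∑ k ∈ s, |a k| * |b k| ≤ 1 := by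
  have hc := Real.HolderConjugate.conjExponent hr
  set r' := r.conjExponent
  have htr : t ≤ r' := by
    have h1 := hc.inv_add_inv_eq_one
    have h2 : r'⁻¹ ≤ t⁻¹ := by
      rw [one_div, one_div] at hrt
      linarith
    exact (inv_le_inv₀ hc.symm.pos ht).1 h2
  have hb1 : ∀ k ∈ s, |b k| ≤ 1 := fun k hk => by
    have h1 : |b k| ^ t ≤ 1 :=
      (Finset.single_le_sum (f := fun k => |b k| ^ t) (fun i _ => by positivity) hk).trans hb
    by_contra! hlt
    exact (Real.one_lt_rpow hlt ht).not_ge h1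
  calc ∑ k ∈ s, |a k| * |b k| ≤ ∑ k ∈ s, (|a k| ^ r / r + |b k| ^ t / r') := by
        refine Finset.sum_le_sum fun k hk => ?_
        refine (Real.young_inequality_of_nonneg (abs_nonneg _) (abs_nonneg _) hc).trans ?_
        have : |b k| ^ r' ≤ |b k| ^ t :=
          Real.rpow_le_rpow_of_exponent_ge_of_imp (abs_nonneg _) (hb1 k hk) htr
            fun _ h0 => absurd h0 hc.symm.pos.ne'
        have := hc.symm.pos
        gcongr
    _ = (∑ k ∈ s, |a k| ^ r) / r + (∑ k ∈ s, |b k| ^ t) / r' := by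
        rw [Finset.sum_add_distrib, Finset.sum_div, Finset.sum_div]
    _ ≤ 1 / r + 1 / r' := by
        have := hc.pos
        have := hc.symm.pos
        gcongr
    _ = 1 := by simpa using hc.inv_add_inv_eq_one

variable {X : Type u} {Y : Type v} [NormedAddCommGroup X] [NormedSpace ℝ X]
  [NormedAddCommGroup Y] [NormedSpace ℝ Y]

/-- The bilinear functional `(a, b) ↦ ∑ k ∈ s, θ k * φ k a * ψ k b`. -/
noncomputable def diagonalForm (φ : ℕ → StrongDual ℝ X) (ψ : ℕ → StrongDual ℝ Y)
    (s : Finset ℕ) (θ : ℕ → ℝ) : X →L[ℝ] Y →L[ℝ] ℝ :=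
  ∑ k ∈ s, (φ k).smulRight (θ k • ψ k)

theorem diagonalForm_apply (φ : ℕ → StrongDual ℝ X) (ψ : ℕ → StrongDual ℝ Y)
    (s : Finset ℕ) (θ : ℕ → ℝ) (a : X) (b : Y) :
    diagonalForm φ ψ s θ a b = ∑ k ∈ s, φ k a * (θ k * ψ k b) := by
  simp [diagonalForm]

theorem norm_diagonalForm_le {r t : ℝ} (hr : 1 < r) (ht : 0 < t) (hrt : 1 ≤ 1 / r + 1 / t)
    {φ : ℕ → StrongDual ℝ X} {ψ : ℕ → StrongDual ℝ Y} (hφ : UpperEstimate r φ)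
    (hψ : UpperEstimate t ψ) (s : Finset ℕ) {θ : ℕ → ℝ} (hθ : ∀ k, |θ k| ≤ 1) :
    ‖diagonalForm φ ψ s θ‖ ≤ 1 := by
  refine ContinuousLinearMap.opNorm_le_of_unit_norm zero_le_one fun a ha =>
    ContinuousLinearMap.opNorm_le_of_unit_norm zero_le_one fun b hb => ?_
  rw [diagonalForm_apply]
  refine (Finset.abs_sum_le_sum_abs _ _).trans ((Finset.sum_le_sum fun k _ => ?_).trans
    (sum_abs_mul_abs_le_one hr ht hrt ((hφ s a).trans_eq (by simp [ha]))
      ((hψ s b).trans_eq (by simp [hb]))))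
  rw [abs_mul, abs_mul]
  gcongr
  exact mul_le_of_le_one_left (abs_nonneg _) (hθ k)

theorem AlgTensor.norm_tmul_le (a : X) (b : Y) : ‖AlgTensor.tmul a b‖ ≤ ‖a‖ * ‖b‖ := by
  have : Nonempty {S : X →L[ℝ] Y →L[ℝ] ℝ // ‖S‖ ≤ 1} :=
    ⟨⟨0, (norm_zero (E := X →L[ℝ] Y →L[ℝ] ℝ)).trans_le zero_le_one⟩⟩
  rw [AlgTensor.norm_def]
  refine ciSup_le fun S => ?_
  rw [AlgTensor.lift_tmul]
  refine (S.1.le_opNorm₂ a b).trans ?_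
  rw [mul_assoc]
  exact mul_le_of_le_one_left (by positivity) S.2

theorem ProjTensor.norm_sum_smul_tmul (s : Finset ℕ) (a : ℕ → ℝ) (x : ℕ → X) (y : ℕ → Y) :
    ‖∑ i ∈ s, a i • ProjTensor.tmul (x i) (y i)‖ =
      ‖∑ i ∈ s, a i • AlgTensor.tmul (x i) (y i)‖ := by
  rw [← UniformSpace.Completion.norm_coe (∑ i ∈ s, a i • AlgTensor.tmul (x i) (y i))]
  congr 1
  have h := map_sum (UniformSpace.Completion.toComplL (𝕜 := ℝ) (E := AlgTensor X Y))
    (fun i => a i • AlgTensor.tmul (x i) (y i)) s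
  simp only [map_smul] at h
  exact h.symm

/-- Elementary tensors tested by diagonal forms: if `φ, ψ` satisfy upper estimates with exponents
`1 / r + 1 / t ≥ 1`, are bounded below on the diagonal, and `φ` is almost biorthogonal to `x`
with error small relative to the bound of `y`, then `x k ⊗ y k` is an `ℓ₁`-sequence. -/
theorem isEllOneSeq_tmul {r t : ℝ} (hr : 1 < r) (ht : 0 < t) (hrt : 1 ≤ 1 / r + 1 / t)
    {φ : ℕ → StrongDual ℝ X} {ψ : ℕ → StrongDual ℝ Y} (hφ : UpperEstimate r φ)
    (hψ : UpperEstimate t ψ) {x : ℕ → X} {y : ℕ → Y} {Mx My δ δ' η : ℝ} (hMx : 0 < Mx)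
    (hMy : 0 < My) (hx : ∀ n, ‖x n‖ ≤ Mx) (hy : ∀ n, ‖y n‖ ≤ My) (hδ : 0 < δ) (hδ' : 0 < δ')
    (hφx : ∀ k, δ ≤ φ k (x k)) (hψy : ∀ k, δ' ≤ ψ k (y k))
    (hoff : ∀ i j, i ≠ j → |φ i (x j)| ≤ η * (1 / 2) ^ i) (hη : 0 < η)
    (hη' : 4 * (η * My) ≤ δ * δ') :
    IsEllOneSeq fun k => ProjTensor.tmul (x k) (y k) := by
  refine ⟨δ * δ' / 2, Mx * My, by positivity, by positivity, fun s a => ?_⟩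
  rw [ProjTensor.norm_sum_smul_tmul]
  constructor
  -- The coefficient signs `θ` make every diagonal term contribute at least `δ * δ' * |a n|`.
  · set θ : ℕ → ℝ := fun k => SignType.sign (a k)
    have hθ : ∀ k, |θ k| ≤ 1 := fun k => by
      simp only [θ]
      cases SignType.sign (a k) <;> simp
    have hθa : ∀ k, a k * θ k = |a k| := fun k => self_mul_sign (a k)
    have hS := AlgTensor.abs_lift_le_norm _ (norm_diagonalForm_le hr ht hrt hφ hψ s hθ)
      (∑ i ∈ s, a i • AlgTensor.tmul (x i) (y i))
    refine le_trans ?_ ((le_abs_self _).trans hS)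
    rw [map_sum, Finset.mul_sum]
    refine Finset.sum_le_sum fun n hn => ?_
    rw [map_smul, AlgTensor.lift_tmul, diagonalForm_apply, smul_eq_mul,
      ← Finset.add_sum_erase s _ hn]
    have hmain : |a n| * (δ * δ') ≤ a n * (φ n (x n) * (θ n * ψ n (y n))) := by
      calc |a n| * (δ * δ') ≤ |a n| * (φ n (x n) * ψ n (y n)) := by
            have h1 := hφx n
            have h2 := hψy n
            have h3 : 0 ≤ φ n (x n) := hδ.le.trans h1
            gcongr
        _ = a n * (φ n (x n) * (θ n * ψ n (y n))) := by rw [← hθa]; ring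
    have herr : |∑ k ∈ s.erase n, φ k (x n) * (θ k * ψ k (y n))| ≤ δ * δ' / 2 := by
      calc |∑ k ∈ s.erase n, φ k (x n) * (θ k * ψ k (y n))|
          ≤ ∑ k ∈ s.erase n, (η * My) * (1 / 2) ^ k := by
            refine (Finset.abs_sum_le_sum_abs _ _).trans (Finset.sum_le_sum fun k hk => ?_)
            rw [abs_mul, abs_mul]
            have h1 := hoff k n (Finset.ne_of_mem_erase hk)
            have h2 : |θ k| * |ψ k (y n)| ≤ My :=
              (mul_le_of_le_one_left (abs_nonneg _) (hθ k)).trans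
                ((hψ.abs_apply_le ht k _).trans (hy n))
            calc |φ k (x n)| * (|θ k| * |ψ k (y n)|) ≤ (η * (1 / 2) ^ k) * My := by gcongr
              _ = (η * My) * (1 / 2) ^ k := by ring
        _ = (η * My) * ∑ k ∈ s.erase n, (1 / 2 : ℝ) ^ k := by rw [Finset.mul_sum]
        _ ≤ (η * My) * 2 := by
            gcongr
            exact (summable_geometric_two.sum_le_tsum _ fun k _ => by positivity).trans_eq
              tsum_geometric_two
        _ ≤ δ * δ' / 2 := by linarith
    have h1 : -(|a n| * (δ * δ' / 2)) ≤ a n * ∑ k ∈ s.erase n, φ k (x n) * (θ k * ψ k (y n)) := by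
      refine (neg_le_neg ?_).trans (neg_abs_le _)
      rw [abs_mul]
      gcongr
    rw [mul_add]
    linarith
  · rw [Finset.mul_sum]
    refine (norm_sum_le _ _).trans (Finset.sum_le_sum fun k _ => ?_)
    rw [norm_smul, Real.norm_eq_abs, mul_comm]
    gcongr
    refine (AlgTensor.norm_tmul_le _ _).trans ?_
    gcongr
    exacts [hx k, hy k]

end Diagonal

/-! ### Extraction of the subsequence -/

theorem theorem3p10 {X : Type u} {Y : Type v}
    [NormedAddCommGroup X] [NormedSpace ℝ X] [CompleteSpace X]
    [NormedAddCommGroup Y] [NormedSpace ℝ Y] [CompleteSpace Y]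
    (p q : ℝ≥0∞) [Fact (1 ≤ p)] [Fact (1 ≤ q)]
    (hp : 1 < p) (hp' : p < ∞) (hq : 1 < q) (hq' : q < ∞) (hpq : 1 ≤ 1 / p + 1 / q)
    (hX : PropertyR p X) (hY : PropertyR q Y)
    (x : ℕ → X) (y : ℕ → Y)
    (hx : WeaklyCauchySeq x) (hy : WeaklyCauchySeq y)
    (hxn : ¬ HasNormConvergentSubseq x) (hyn : ¬ HasNormConvergentSubseq y) :
    ∃ φ : ℕ → ℕ, StrictMono φ ∧
      IsEllOneSeq (fun k => ProjTensor.tmul (x (φ k)) (y (φ k))) := by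
  have hr : 1 < p.toReal := by
    simpa using (ENNReal.toReal_lt_toReal ENNReal.one_ne_top hp'.ne).2 hp
  have ht : 1 < q.toReal := by
    simpa using (ENNReal.toReal_lt_toReal ENNReal.one_ne_top hq'.ne).2 hq
  have hrt : 1 ≤ 1 / p.toReal + 1 / q.toReal := by
    have hpt : 1 / p ≠ ∞ := by simpa using (zero_lt_one.trans hp).ne'
    have hqt : 1 / q ≠ ∞ := by simpa using (zero_lt_one.trans hq).ne'
    have h := ENNReal.toReal_mono (ENNReal.add_ne_top.2 ⟨hpt, hqt⟩) hpq
    rw [ENNReal.toReal_add hpt hqt] at h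
    simpa using h
  obtain ⟨Mx, hMx, hxM⟩ := hx.exists_norm_le
  obtain ⟨My, hMy, hyM⟩ := hy.exists_norm_le
  obtain ⟨n₁, f, δ, hn₁, hδ, hf, hfx⟩ := hX.exists_upperEstimate hp'.ne hx
    (not_cauchySeq_comp_of_not_hasNormConvergentSubseq hxn strictMono_id)
  obtain ⟨n₂, g, δ', hn₂, hδ', hg, hgy⟩ := hY.exists_upperEstimate hq'.ne (hy.comp hn₁)
    (not_cauchySeq_comp_of_not_hasNormConvergentSubseq hyn hn₁)
  have hη : 0 < δ * δ' / (4 * My) := by positivity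
  obtain ⟨n₃, hn₃, hoff⟩ := (hf.comp hn₂).exists_almost_biorthogonal (zero_lt_one.trans hr)
    (hx.comp (hn₁.comp hn₂)) hη
  refine ⟨n₁ ∘ n₂ ∘ n₃, hn₁.comp (hn₂.comp hn₃), ?_⟩
  refine isEllOneSeq_tmul hr (zero_lt_one.trans ht) hrt ((hf.comp hn₂).comp hn₃) (hg.comp hn₃)
    hMx hMy (fun _ => hxM _) (fun _ => hyM _) hδ hδ' (fun k => hfx _) (fun k => hgy _) hoff hη ?_
  exact le_of_eq (by field_simp)
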